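/- Let $d\ge 1$ and $N\ge 1$. A *repulsive cost* is a function $c:(\mathbb R^d)^N\to[0,+\infty]$ of the form \[ c(x_1,\dots,x_N)=\sum_{1\le i<j\le N}\frac{1}{\omega(|x_i-x_j|)}, \] where $\omega:[0,\infty)\to[0,\infty)$ is continuous and strictly increasing with $\omega(0)=0$, and $1/0=+\infty$. Let $\rho$ be a Borel probability measure on $\mathbb R^d$ whose concentration satisfies \[ \sup_{x\in\mathbb R^d}\rho(\{x\})<\frac1N. \] A *symmetric plan* for $\rho$ is a Borel probability measure $P$ on $(\mathbb R^d)^N$ that is invariant under all permutations of the $N$ factors and whose $N$ marginals on $\mathbb R^d$ are all equal to $\rho$. Then: 1. for every repulsive cost $c$, \[ \inf\Big\{\int_{(\mathbb R^d)^N} c\,\mathrm dP \;:\; P \text{ a symmetric plan for } \rho\Big\}<+\infty; \] 2. there exist $\alpha>0$ and a symmetric plan $P$ for $\rho$, depending only on $\rho$ and $N$ and not on the cost, such that the support of $P$ is disjoint from $\{(x_1,\dots,x_N) : \exists\, i\ne j,\ |x_i-x_j|<\alpha\}$, and $\int c\,\mathrm dP<+\infty$ for every repulsive cost $c$. -/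

import Mathlib

open MeasureTheory
open scoped NNReal ENNReal

namespace RepulsiveTransport

/-- The space `ℝ^d` with its Euclidean norm. -/
abbrev Pt (d : ℕ) : Type := EuclideanSpace ℝ (Fin d)

/-- The space `(ℝ^d)^N` of configurations of `N` points of `ℝ^d`. -/
abbrev Config (d N : ℕ) : Type := Fin N → Pt d

/-- `c` is a repulsive cost: `c(x₁,…,x_N) = ∑_{i<j} 1 / ω(|x_i - x_j|)` for some continuous,
strictly increasing `ω : [0,∞) → [0,∞)` with `ω 0 = 0`. The cost takes values in `[0,∞]`, and a
term is `∞` exactly where `x_i = x_j`. Differentiability of `ω` on `(0,∞)` is not required. -/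
def IsRepulsiveCost {d N : ℕ} (c : Config d N → ℝ≥0∞) : Prop :=
  ∃ ω : ℝ≥0 → ℝ≥0, Continuous ω ∧ StrictMono ω ∧ ω 0 = 0 ∧
    ∀ x : Config d N, c x =
      ∑ p : Fin N × Fin N with p.1 < p.2, 1 / (ω ‖x p.1 - x p.2‖₊ : ℝ≥0∞)

/-- The concentration `sup_x ρ({x})` of a measure on `ℝ^d`. -/
noncomputable def concentration {d : ℕ} (ρ : Measure (Pt d)) : ℝ≥0∞ :=
  ⨆ x : Pt d, ρ {x}

/-- `P` is a symmetric `N`-transport plan with all marginals equal to `ρ`: a probability measure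
on `(ℝ^d)^N` that is invariant under every permutation of the `N` points and whose projection on
each factor is `ρ`. -/
structure IsSymmetricPlan {d N : ℕ} (ρ : Measure (Pt d)) (P : Measure (Config d N)) : Prop where
  isProbabilityMeasure : IsProbabilityMeasure P
  symmetric : ∀ s : Equiv.Perm (Fin N), P.map (fun x : Config d N => fun i => x (s i)) = P
  marginal : ∀ i : Fin N, P.map (fun x : Config d N => x i) = ρ

/-- The infimum of `∫ c dP` over all symmetric transport plans `P` with marginals `ρ`
(it is `∞` if there is no such plan of finite cost). -/
noncomputable def symmetricTransportCost {d N : ℕ} (c : Config d N → ℝ≥0∞)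
    (ρ : Measure (Pt d)) : ℝ≥0∞ :=
  ⨅ (P : Measure (Config d N)) (_ : IsSymmetricPlan ρ P), ∫⁻ x, c x ∂P

/-- The set of configurations in which two of the points are at distance less than `α`. -/
def nearDiagonal (d N : ℕ) (α : ℝ) : Set (Config d N) :=
  {x | ∃ i j : Fin N, i ≠ j ∧ ‖x i - x j‖ < α}

end RepulsiveTransport

/-! The problem reduces to a finite one. Since `arctan` is injective and 1-Lipschitz, it moves `ρ`
to a compact cube without creating larger atoms, and separation there implies separation in `ℝ^d`.
By compactness some single scale `δ` gives every ball of radius `4 * δ` mass below `1/N`. Partition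
into cells with weights `u c = N ρ(c)`: the total is `N` and every neighbourhood weighs less than 1.
Such a `u` is a convex combination of occupation vectors of separated `N`-tuples: otherwise
Hahn–Banach gives a linear functional contradicted by a greedy choice of tuple. Replacing each cell
by `ρ` conditioned on it, mixing the products and symmetrizing gives the plan. Off the near-diagonal
every repulsive cost is bounded. -/

namespace RepulsiveTransport

/-! ### Finite combinatorics: weights as mixtures of separated tuples -/

/-- Greedy choice: if the weight `u` has total mass `n` and every neighbourhood has weight less
than one, then some pairwise separated `n`-tuple has `f`-sum at least the `u`-weighted sum of `f`. -/
theorem exists_separated_tuple_sum_ge {ι : Type*} [Fintype ι] (near : ι → ι → Prop)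
    [DecidableRel near] (hsymm : ∀ a b, near a b → near b a) (f : ι → ℝ) :
    ∀ (n : ℕ) (u : ι → ℝ), (∀ c, 0 ≤ u c) → ∑ c, u c = n →
      (∀ c, ∑ c' with near c c', u c' < 1) →
      ∃ s : Fin n → ι, ((∀ k, u (s k) ≠ 0) ∧ ∀ i j, i ≠ j → ¬ near (s i) (s j)) ∧
        ∑ c, u c * f c ≤ ∑ k, f (s k) := by
  intro n
  induction n with
  | zero =>
    intro u hu hsum _
    have h0 : ∀ c, u c = 0 := by
      intro c
      have := (Finset.sum_eq_zero_iff_of_nonneg (fun c _ => hu c)).1 (by simpa using hsum)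
      exact this c (Finset.mem_univ c)
    exact ⟨Fin.elim0, ⟨fun k => k.elim0, fun i => i.elim0⟩, by simp [h0]⟩
  | succ n ih =>
    intro u hu hsum hnear
    have hne : (Finset.univ.filter fun c => u c ≠ 0).Nonempty := by
      by_contra h
      rw [Finset.not_nonempty_iff_eq_empty, Finset.filter_eq_empty_iff] at h
      have h0 : ∑ c, u c = 0 := Finset.sum_eq_zero fun c hc => by simpa using h hc
      rw [h0] at hsum
      have : (0 : ℝ) < ((n + 1 : ℕ) : ℝ) := by positivity
      linarith
    obtain ⟨a, ha, hmax⟩ := Finset.exists_max_image _ f hne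
    replace ha : u a ≠ 0 := (Finset.mem_filter.1 ha).2
    replace hmax : ∀ c, u c ≠ 0 → f c ≤ f a := fun c hc => hmax c (by simpa using hc)
    set m : ℝ := ∑ c with ¬ near a c, u c with hm
    have hsplit := Finset.sum_filter_add_sum_filter_not Finset.univ (near a) u
    have hmn : (n : ℝ) < m := by
      have := hnear a
      push_cast at hsum
      linarith
    have hn0 : (0 : ℝ) ≤ n := n.cast_nonneg
    have hm0 : 0 < m := hn0.trans_lt hmn
    -- Discard the neighbours of `a` and rescale the rest to mass `n`. Fewer than one unit is lost,
    -- so the factor is at most 1 and the neighbourhood bounds survive.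
    let u' : ι → ℝ := fun c => if near a c then 0 else (n / m) * u c
    have hlam : (n : ℝ) / m ≤ 1 := (div_le_one hm0).2 hmn.le
    have hu'0 : ∀ c, 0 ≤ u' c := fun c => by
      simp only [u']; split_ifs
      · exact le_rfl
      · exact mul_nonneg (by positivity) (hu c)
    have hu'le : ∀ c, u' c ≤ u c := fun c => by
      simp only [u']; split_ifs
      · exact hu c
      · exact mul_le_of_le_one_left (hu c) hlam
    have hsum' : ∑ c, u' c = n := by
      have : ∑ c, u' c = (n / m) * m := by
        rw [hm, Finset.mul_sum, Finset.sum_filter]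
        exact Finset.sum_congr rfl fun c _ => by by_cases h : near a c <;> simp [u', h, ← hm]
      rw [this]; field_simp
    obtain ⟨s, ⟨hs1, hs2⟩, hs3⟩ := ih u' hu'0 hsum'
      fun c => (Finset.sum_le_sum fun c' _ => hu'le c').trans_lt (hnear c)
    have hsa : ∀ k, ¬ near a (s k) := fun k h => hs1 k (by simp [u', h])
    refine ⟨Fin.cons a s, ⟨?_, ?_⟩, ?_⟩
    · intro k
      refine Fin.cases ?_ (fun k => ?_) k
      · simpa using ha
      · have h1 := hs1 k
        have h2 : u (s k) ≠ 0 := fun h => h1 (by simp [u', h])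
        simpa using h2
    · intro i j
      refine Fin.cases ?_ (fun i => ?_) i <;> refine Fin.cases ?_ (fun j => ?_) j
      · simp
      · intro _; simpa using hsa j
      · intro _ h; exact hsa i (hsymm _ _ (by simpa using h))
      · intro hij; simpa using hs2 i j (by simpa using hij)
    · rw [Fin.sum_univ_succ]
      simp only [Fin.cons_zero, Fin.cons_succ]
      -- The removed weight `u - u'` is nonnegative, has total mass 1 and lives where `f ≤ f a`.
      have key : ∑ c, (u c - u' c) * f c ≤ ∑ c, (u c - u' c) * f a := by
        refine Finset.sum_le_sum fun c _ => ?_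
        by_cases hc : u c = 0
        · have : u' c = 0 := le_antisymm (hc ▸ hu'le c) (hu'0 c)
          simp [hc, this]
        · exact mul_le_mul_of_nonneg_left (hmax c hc) (sub_nonneg.2 (hu'le c))
      rw [← Finset.sum_mul, Finset.sum_sub_distrib, hsum, hsum'] at key
      simp only [sub_mul, Finset.sum_sub_distrib] at key
      push_cast at key
      linarith


/-- A weight of total mass `n` whose neighbourhoods all have weight less than one is the
expected occupation of a random pairwise separated `n`-tuple. -/
theorem exists_separated_tuple_weights {ι : Type*} [Fintype ι] (near : ι → ι → Prop)
    [DecidableRel near] (hsymm : ∀ a b, near a b → near b a) (n : ℕ) (u : ι → ℝ)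
    (hu : ∀ c, 0 ≤ u c) (hsum : ∑ c, u c = n) (hnear : ∀ c, ∑ c' with near c c', u c' < 1) :
    ∃ (κ : Type) (_ : Fintype κ) (p : κ → ℝ) (s : κ → Fin n → ι), (∀ a, 0 ≤ p a) ∧ ∑ a, p a = 1 ∧
      (∀ a, (∀ k, u (s a k) ≠ 0) ∧ ∀ i j, i ≠ j → ¬ near (s a i) (s a j)) ∧
      ∀ φ : ι → ℝ, ∑ a, p a * ∑ k, φ (s a k) = ∑ c, u c * φ c := by
  classical
  let G := {s : Fin n → ι // (∀ k, u (s k) ≠ 0) ∧ ∀ i j, i ≠ j → ¬ near (s i) (s j)}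
  let v : G → ι → ℝ := fun s => ∑ k, Pi.single (s.1 k) 1
  have hv : ∀ (s : G) (φ : ι → ℝ), ∑ c, v s c * φ c = ∑ k, φ (s.1 k) := by
    intro s φ
    simp only [v, Finset.sum_apply, Finset.sum_mul]
    rw [Finset.sum_comm]
    exact Finset.sum_congr rfl fun k _ => by simp [Pi.single_apply]
  have hmem : u ∈ convexHull ℝ (Set.range v) := by
    by_contra hnot
    obtain ⟨L, t, hL, hLu⟩ := geometric_hahn_banach_closed_point (convex_convexHull ℝ (Set.range v))
      ((Set.finite_range v).isClosed_convexHull ℝ) hnot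
    have hLf : ∀ x : ι → ℝ, L x = ∑ c, x c * L (Pi.single c 1) := by
      intro x
      conv_lhs => rw [pi_eq_sum_univ' x, map_sum]
      exact Finset.sum_congr rfl fun c _ => by
        rw [map_smul, smul_eq_mul]
    obtain ⟨s, hs, hle⟩ := exists_separated_tuple_sum_ge near hsymm (fun c => L (Pi.single c 1))
      n u hu hsum hnear
    have h1 := hL (v ⟨s, hs⟩) (subset_convexHull ℝ _ ⟨_, rfl⟩)
    rw [hLf, hv] at h1
    rw [hLf] at hLu
    linarith
  obtain ⟨κ, _, p, z, hp0, hp1, hz, hpz⟩ := mem_convexHull_iff_exists_fintype.1 hmem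
  choose s hs using hz
  refine ⟨κ, inferInstance, p, fun a => (s a).1, hp0, hp1, fun a => (s a).2, fun φ => ?_⟩
  simp_rw [← hpz, ← hs, Finset.sum_apply, Finset.sum_mul, ← hv, Pi.smul_apply, smul_eq_mul,
    Finset.mul_sum, mul_assoc]
  exact Finset.sum_comm

/-! ### A uniform scale from compactness -/

open Filter in
theorem exists_forall_measure_ball_lt {Y : Type*} [MetricSpace Y] [CompactSpace Y]
    [MeasurableSpace Y] [BorelSpace Y] (μ : Measure Y) [IsFiniteMeasure μ] {ε : ℝ≥0∞}
    (h : ∀ y, μ {y} < ε) : ∃ r > 0, ∀ y, μ (Metric.ball y r) < ε := by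
  have h1 : ∀ y, ∃ r > 0, μ (Metric.closedBall y r) < ε := by
    intro y
    have ht := tendsto_measure_cthickening_of_isClosed (μ := μ) (s := {y})
      ⟨1, one_pos, measure_ne_top _ _⟩ isClosed_singleton
    have hev := (ht.mono_left (nhdsWithin_le_nhds (s := Set.Ioi 0))).eventually (gt_mem_nhds (h y))
    obtain ⟨r, hr, hr0⟩ := (hev.and self_mem_nhdsWithin).exists
    exact ⟨r, hr0, by rwa [Metric.cthickening_singleton _ (le_of_lt hr0)] at hr⟩
  choose r hr0 hr using h1
  obtain ⟨δ, hδ, hball⟩ := lebesgue_number_lemma_of_metric (isCompact_univ (X := Y))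
    (c := fun y => Metric.ball y (r y)) (fun _ => Metric.isOpen_ball)
    (fun y _ => Set.mem_iUnion.2 ⟨y, Metric.mem_ball_self (hr0 y)⟩)
  refine ⟨δ, hδ, fun y => ?_⟩
  obtain ⟨z, hz⟩ := hball y (Set.mem_univ y)
  exact (measure_mono (hz.trans Metric.ball_subset_closedBall)).trans_lt (hr z)

/-- Rounding to a finite `r / 4`-net, with `δ = r / 4`: rounding moves points by less than `δ`, so
the set in question lies in a ball of radius `3 * δ + δ = r`. -/
theorem exists_simpleFunc_measure_near_lt {Y : Type*} [MetricSpace Y] [CompactSpace Y] [Nonempty Y]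
    [MeasurableSpace Y] [BorelSpace Y] (μ : Measure Y) [IsFiniteMeasure μ] {ε : ℝ≥0∞}
    (h : ∀ y, μ {y} < ε) : ∃ (F : SimpleFunc Y Y) (δ : ℝ), 0 < δ ∧ (∀ y, dist (F y) y < δ) ∧
      ∀ c, μ {y | dist c (F y) < 3 * δ} < ε := by
  obtain ⟨r, hr0, hr⟩ := exists_forall_measure_ball_lt μ h
  let e := TopologicalSpace.denseSeq Y
  obtain ⟨t, ht⟩ := (isCompact_univ (X := Y)).elim_finite_subcover
    (fun n => Metric.ball (e n) (r / 4)) (fun _ => Metric.isOpen_ball) (fun y _ => by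
      obtain ⟨n, hn⟩ := (TopologicalSpace.denseRange_denseSeq Y).exists_dist_lt y
        (show 0 < r / 4 by positivity)
      exact Set.mem_iUnion.2 ⟨n, hn⟩)
  obtain ⟨M, hM⟩ := t.exists_le
  have hF : ∀ y, dist (SimpleFunc.nearestPt e M y) y < r / 4 := by
    intro y
    obtain ⟨k, hk, hky⟩ := Set.mem_iUnion₂.1 (ht (Set.mem_univ y))
    have h1 := SimpleFunc.edist_nearestPt_le e y (hM k hk)
    rw [edist_dist, edist_dist, ENNReal.ofReal_le_ofReal_iff dist_nonneg] at h1
    rw [Metric.mem_ball, dist_comm] at hky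
    exact h1.trans_lt hky
  refine ⟨SimpleFunc.nearestPt e M, r / 4, by positivity, hF, fun c => ?_⟩
  refine (measure_mono fun y hy => ?_).trans_lt (hr c)
  have h2 : dist c (SimpleFunc.nearestPt e M y) < 3 * (r / 4) := hy
  have h3 := hF y
  have h4 := dist_triangle c (SimpleFunc.nearestPt e M y) y
  rw [Metric.mem_ball, dist_comm]
  linarith

/-! ### Compactification by `arctan` -/

/-- The map `ℝ^d → [-π/2, π/2]^d` applying `arctan` to every coordinate. -/
noncomputable def arctanMap (d : ℕ) (x : Pt d) : Fin d → Set.Icc (-(Real.pi / 2)) (Real.pi / 2) :=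
  fun i => ⟨Real.arctan (x i), (Real.neg_pi_div_two_lt_arctan _).le, (Real.arctan_lt_pi_div_two _).le⟩

theorem arctanMap_injective (d : ℕ) : Function.Injective (arctanMap d) := by
  intro x y hxy
  ext i
  have := congrArg Subtype.val (congrFun hxy i)
  exact Real.arctan_injective this

theorem continuous_arctanMap (d : ℕ) : Continuous (arctanMap d) := by
  unfold arctanMap
  fun_prop

theorem dist_arctan_le (a b : ℝ) : dist (Real.arctan a) (Real.arctan b) ≤ dist a b := by
  have : LipschitzWith 1 Real.arctan := lipschitzWith_of_nnnorm_deriv_le Real.differentiable_arctan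
    fun x => by
      rw [← NNReal.coe_le_coe, coe_nnnorm, Real.deriv_arctan, Real.norm_of_nonneg (by positivity)]
      simpa using inv_le_one_of_one_le₀ (by nlinarith [sq_nonneg x] : (1 : ℝ) ≤ 1 + x ^ 2)
  simpa using this.dist_le_mul a b

theorem dist_arctanMap_le {d : ℕ} (x y : Pt d) : dist (arctanMap d x) (arctanMap d y) ≤ dist x y := by
  refine (dist_pi_le_iff dist_nonneg).2 fun i => ?_
  refine (dist_arctan_le (x i) (y i)).trans ?_
  rw [dist_eq_norm, dist_eq_norm]
  exact PiLp.norm_apply_le (x - y) i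

/-! ### Construction of the plan -/

/-- Averaging over permutations makes a plan with average marginal `ρ` into a symmetric plan. -/
theorem exists_symmetric_plan {d N : ℕ} (hN : 1 ≤ N) (ρ : Measure (Pt d))
    (Q : Measure (Config d N)) [IsProbabilityMeasure Q]
    (hmarg : ∑ k, Q.map (fun x : Config d N => x k) = (N : ℝ≥0∞) • ρ)
    {S : Set (Config d N)} (hS : MeasurableSet S)
    (hSperm : ∀ (σ : Equiv.Perm (Fin N)) (x : Config d N), (fun i => x (σ i)) ∈ S → x ∈ S)
    (hQ : Q S = 0) : ∃ P : Measure (Config d N), IsSymmetricPlan ρ P ∧ P S = 0 := by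
  have hmeas : ∀ σ : Equiv.Perm (Fin N), Measurable fun (x : Config d N) i => x (σ i) :=
    fun σ => by fun_prop
  have hN0 : (N : ℝ≥0∞) ≠ 0 := by exact_mod_cast (by omega : N ≠ 0)
  have hf0 : (N.factorial : ℝ≥0∞) ≠ 0 := by exact_mod_cast N.factorial_ne_zero
  have hft : (N.factorial : ℝ≥0∞) ≠ ⊤ := ENNReal.natCast_ne_top _
  let R : Measure (Config d N) :=
    ∑ σ : Equiv.Perm (Fin N), Q.map fun x i => x (σ i)
  have hRapply : ∀ A, MeasurableSet A → R A = ∑ σ : Equiv.Perm (Fin N), Q ((fun x i => x (σ i)) ⁻¹' A) := by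
    intro A hA
    simp only [R, Measure.finsetSum_apply]
    exact Finset.sum_congr rfl fun σ _ => Measure.map_apply (hmeas σ) hA
  refine ⟨(N.factorial : ℝ≥0∞)⁻¹ • R, ⟨⟨?_⟩, fun τ => ?_, fun i => ?_⟩, ?_⟩
  · rw [Measure.smul_apply, hRapply _ .univ]
    simp [Fintype.card_perm, ENNReal.inv_mul_cancel hf0 hft]
  · rw [Measure.map_smul]
    congr 1
    ext A hA
    rw [Measure.map_apply (hmeas τ) hA, hRapply _ hA, hRapply _ (hmeas τ hA)]
    exact Fintype.sum_equiv (Equiv.mulRight τ) _ _ fun σ => rfl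
  · rw [Measure.map_smul]
    ext A hA
    have hA' : ∀ k, MeasurableSet ((fun x : Config d N => x k) ⁻¹' A) :=
      fun k => measurable_pi_apply k hA
    rw [Measure.smul_apply, Measure.map_apply (measurable_pi_apply i) hA, hRapply _ (hA' i)]
    let q : Fin N → ℝ≥0∞ := fun k => Q ((fun x : Config d N => x k) ⁻¹' A)
    have hq : ∑ k, q k = N * ρ A := by
      have := congrArg (fun m : Measure (Pt d) => m A) hmarg
      simp only [Measure.finsetSum_apply, Measure.smul_apply, smul_eq_mul] at this
      rw [← this]
      exact Finset.sum_congr rfl fun k _ => (Measure.map_apply (measurable_pi_apply k) hA).symm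
    change (N.factorial : ℝ≥0∞)⁻¹ • ∑ σ : Equiv.Perm (Fin N), q (σ i) = ρ A
    -- The sum does not depend on the coordinate, so averaging over coordinates evaluates it through
    -- `hmarg`.
    have hconst : ∀ j, ∑ σ : Equiv.Perm (Fin N), q (σ j) = ∑ σ : Equiv.Perm (Fin N), q (σ i) := by
      intro j
      exact Fintype.sum_equiv (Equiv.mulRight (Equiv.swap i j)) _ _ fun σ => by simp
    have htot : (N : ℝ≥0∞) * ∑ σ : Equiv.Perm (Fin N), q (σ i) = N * (N.factorial * ρ A) := by
      calc (N : ℝ≥0∞) * ∑ σ : Equiv.Perm (Fin N), q (σ i)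
          = ∑ j : Fin N, ∑ σ : Equiv.Perm (Fin N), q (σ j) := by simp [hconst]
        _ = ∑ σ : Equiv.Perm (Fin N), ∑ k, q k := by
          rw [Finset.sum_comm]
          exact Finset.sum_congr rfl fun σ _ => Equiv.sum_comp σ q
        _ = N * (N.factorial * ρ A) := by
          rw [hq]; simp [Fintype.card_perm]; ring
    rw [(ENNReal.mul_right_inj hN0 (ENNReal.natCast_ne_top N)).1 htot, smul_eq_mul, ← mul_assoc,
      ENNReal.inv_mul_cancel hf0 hft, one_mul]
  · rw [Measure.smul_apply, hRapply _ hS, Finset.sum_eq_zero, smul_zero]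
    exact fun σ _ => measure_mono_null (fun x hx => hSperm σ x hx) hQ

/-- A mixture of products of conditional measures, with average marginal `ρ`, that charges only
configurations whose points lie in pairwise separated cells of the partition `g`. -/
theorem exists_mixture_plan {X ι : Type*} [MeasurableSpace X] [Fintype ι] (ρ : Measure X)
    [IsProbabilityMeasure ρ] (g : X → ι) (hg : ∀ c, MeasurableSet (g ⁻¹' {c}))
    (near : ι → ι → Prop) (hsymm : ∀ a b, near a b → near b a) {N : ℕ} (hN : 1 ≤ N)
    (hnear : ∀ c, ρ {x | near c (g x)} < 1 / N) :
    ∃ Q : Measure (Fin N → X), IsProbabilityMeasure Q ∧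
      (∀ᵐ x ∂Q, ∀ i j, i ≠ j → ¬ near (g (x i)) (g (x j))) ∧
      ∑ k, Q.map (fun x => x k) = (N : ℝ≥0∞) • ρ := by
  classical
  have hN0 : (0 : ℝ) < N := by exact_mod_cast hN
  have hpart : ∀ (A : Set X), MeasurableSet A → ∀ t : Finset ι,
      ∑ c ∈ t, ρ.real (A ∩ g ⁻¹' {c}) = ρ.real (A ∩ {x | g x ∈ t}) := by
    intro A hA t
    rw [← measureReal_biUnion_finset]
    · congr 1; ext x; simp
    · intro a _ b _ hab
      refine Set.disjoint_left.2 fun x hx hx' => hab ?_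
      rw [← hx.2, ← hx'.2]
    · exact fun c _ => hA.inter (hg c)
  let u : ι → ℝ := fun c => N * ρ.real (g ⁻¹' {c})
  have hpos : ∀ c, u c ≠ 0 → ρ (g ⁻¹' {c}) ≠ 0 := by
    intro c hc h
    exact hc (by simp [u, Measure.real, h])
  obtain ⟨κ, _, p, s, hp0, hp1, hs, hpφ⟩ := exists_separated_tuple_weights near hsymm N u
    (fun c => by positivity)
    (by
      have := hpart Set.univ .univ Finset.univ
      simp only [Set.univ_inter, Finset.mem_univ, Set.ofPred_true, probReal_univ] at this
      simp only [u]
      rw [← Finset.mul_sum, this, mul_one])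
    (by
      intro c
      have := hpart Set.univ .univ (Finset.univ.filter (near c))
      simp only [Set.univ_inter, Finset.mem_filter, Finset.mem_univ, true_and] at this
      simp only [u]
      rw [← Finset.mul_sum, this]
      have h2 := hnear c
      have h3 : ρ.real {x | near c (g x)} < 1 / N := by
        have := ENNReal.toReal_strict_mono (by simp; omega) h2
        simpa [Measure.real] using this
      rwa [lt_div_iff₀' hN0] at h3)
  -- The tuples use only cells of positive mass, so each conditional measure is a probability.
  let ν : κ → Measure (Fin N → X) := fun a =>
    Measure.pi fun k => ProbabilityTheory.cond ρ (g ⁻¹' {s a k})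
  have hcond : ∀ c, u c ≠ 0 → IsProbabilityMeasure (ProbabilityTheory.cond ρ (g ⁻¹' {c})) :=
    fun c hc => ProbabilityTheory.cond_isProbabilityMeasure (hpos c hc)
  have hν : ∀ a, IsProbabilityMeasure (ν a) := fun a => by
    have := fun k => hcond _ ((hs a).1 k)
    exact inferInstanceAs (IsProbabilityMeasure (Measure.pi _))
  have hνk : ∀ a k, (ν a).map (fun x => x k) = ProbabilityTheory.cond ρ (g ⁻¹' {s a k}) := by
    intro a k
    have := fun k => hcond _ ((hs a).1 k)
    exact (measurePreserving_eval (fun k => ProbabilityTheory.cond ρ (g ⁻¹' {s a k})) k).map_eq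
  refine ⟨∑ a, ENNReal.ofReal (p a) • ν a, ⟨?_⟩, ?_, ?_⟩
  · simp only [Measure.finsetSum_apply, Measure.smul_apply, measure_univ, smul_eq_mul, mul_one]
    rw [← ENNReal.ofReal_sum_of_nonneg (fun a _ => hp0 a), hp1, ENNReal.ofReal_one]
  · rw [← Measure.sum_fintype, Measure.ae_sum_iff]
    intro a
    refine Measure.ae_smul_measure ?_ _
    have hk : ∀ k, ∀ᵐ x ∂ν a, g (x k) = s a k := by
      intro k
      have h1 : ∀ᵐ y ∂((ν a).map fun x => x k), g y = s a k := by
        rw [hνk]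
        exact ProbabilityTheory.ae_cond_mem (hg _)
      exact ae_of_ae_map (measurable_pi_apply k).aemeasurable h1
    filter_upwards [ae_all_iff.2 hk] with x hx i j hij
    rw [hx, hx]
    exact (hs a).2 i j hij
  · ext A hA
    have e1 : ∀ k, (∑ a, ENNReal.ofReal (p a) • ν a).map (fun x => x k) A
        = ∑ a, ENNReal.ofReal (p a * (ProbabilityTheory.cond ρ (g ⁻¹' {s a k})).real A) := by
      intro k
      rw [Measure.map_apply (measurable_pi_apply k) hA, Measure.finsetSum_apply]
      refine Finset.sum_congr rfl fun a _ => ?_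
      rw [Measure.smul_apply, ← Measure.map_apply (measurable_pi_apply k) hA, hνk, smul_eq_mul,
        ENNReal.ofReal_mul (hp0 a), Measure.real, ENNReal.ofReal_toReal (measure_ne_top _ _)]
    simp only [Measure.finsetSum_apply, e1]
    rw [Finset.sum_comm]
    -- Testing the mixture identity on `c ↦ ρ(A | c)` turns it into the law of total probability.
    have e2 := hpφ fun c => (ProbabilityTheory.cond ρ (g ⁻¹' {c})).real A
    have e3 : ∀ c, u c * (ProbabilityTheory.cond ρ (g ⁻¹' {c})).real A
        = N * ρ.real (A ∩ g ⁻¹' {c}) := by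
      intro c
      by_cases hc : ρ (g ⁻¹' {c}) = 0
      · have : ρ (A ∩ g ⁻¹' {c}) = 0 := measure_mono_null Set.inter_subset_right hc
        simp [u, Measure.real, hc, this]
      · have hc' : ρ.real (g ⁻¹' {c}) ≠ 0 := by
          simpa [Measure.real, ENNReal.toReal_eq_zero_iff] using hc
        have hcA : (ProbabilityTheory.cond ρ (g ⁻¹' {c})).real A
            = (ρ.real (g ⁻¹' {c}))⁻¹ * ρ.real (A ∩ g ⁻¹' {c}) := by
          simp [Measure.real, ProbabilityTheory.cond_apply (hg c), Set.inter_comm]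
        rw [hcA]
        simp only [u]
        field_simp
    simp only [e3] at e2
    rw [← Finset.mul_sum, hpart A hA Finset.univ] at e2
    simp only [Finset.mem_univ, Set.ofPred_true, Set.inter_univ] at e2
    simp_rw [Finset.mul_sum] at e2
    have hnn : ∀ a, ∀ k, 0 ≤ p a * (ProbabilityTheory.cond ρ (g ⁻¹' {s a k})).real A :=
      fun a k => mul_nonneg (hp0 a) measureReal_nonneg
    simp_rw [← ENNReal.ofReal_sum_of_nonneg (fun k _ => hnn _ k)]
    rw [← ENNReal.ofReal_sum_of_nonneg (fun a _ => Finset.sum_nonneg fun k _ => hnn a k), e2,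
      ENNReal.ofReal_mul hN0.le, Measure.real, ENNReal.ofReal_toReal (measure_ne_top _ _),
      ENNReal.ofReal_natCast, Measure.smul_apply, smul_eq_mul]

theorem isOpen_nearDiagonal (d N : ℕ) (α : ℝ) : IsOpen (nearDiagonal d N α) := by
  have : nearDiagonal d N α = ⋃ (i : Fin N) (j : Fin N) (_ : i ≠ j),
      {x : Config d N | ‖x i - x j‖ < α} := by
    ext x; simp [nearDiagonal]
  rw [this]
  exact isOpen_iUnion fun i => isOpen_iUnion fun j => isOpen_iUnion fun _ =>
    isOpen_lt (by fun_prop) continuous_const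

theorem exists_separated_symmetric_plan {d N : ℕ} (hN : 1 ≤ N) (ρ : Measure (Pt d))
    [IsProbabilityMeasure ρ] (hρ : concentration ρ < 1 / (N : ℝ≥0∞)) :
    ∃ α : ℝ, 0 < α ∧ ∃ P : Measure (Config d N), IsSymmetricPlan ρ P ∧
      P (nearDiagonal d N α) = 0 := by
  have hmeas := (continuous_arctanMap d).measurable
  have hatom : ∀ y, ρ.map (arctanMap d) {y} < 1 / (N : ℝ≥0∞) := by
    intro y
    rw [Measure.map_apply hmeas (measurableSet_singleton y)]
    rcases (arctanMap d ⁻¹' {y}).eq_empty_or_nonempty with h | ⟨x, hx⟩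
    · rw [h, measure_empty]; exact bot_le.trans_lt hρ
    · refine (measure_mono fun z hz => ?_).trans_lt ((le_iSup (fun x => ρ {x}) x).trans_lt hρ)
      exact arctanMap_injective d (hz.trans hx.symm)
  have : Nonempty (Fin d → Set.Icc (-(Real.pi / 2)) (Real.pi / 2)) := ⟨arctanMap d 0⟩
  have := Measure.isProbabilityMeasure_map (μ := ρ) hmeas.aemeasurable
  obtain ⟨F, δ, hδ, hF, hFμ⟩ := exists_simpleFunc_measure_near_lt (ρ.map (arctanMap d)) hatom
  let g : Pt d → F.range := fun x => ⟨F (arctanMap d x), F.mem_range_self _⟩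
  have hFm : Measurable fun x => F (arctanMap d x) := F.measurable.comp hmeas
  obtain ⟨Q, hQ1, hQ2, hQ3⟩ := exists_mixture_plan ρ g
    (fun c => by
      convert hFm (measurableSet_singleton c.1) using 1
      ext x; simp [g, Subtype.ext_iff])
    -- Points closer than `δ` round to cells closer than `δ + δ + δ`.
    (fun a b => dist a.1 b.1 < 3 * δ) (fun a b h => by rwa [dist_comm]) hN
    (fun c => by
      have := hFμ c.1
      rwa [Measure.map_apply hmeas] at this
      exact measurableSet_lt (by fun_prop) measurable_const)
  obtain ⟨P, hP, hP0⟩ := exists_symmetric_plan hN ρ Q hQ3 (isOpen_nearDiagonal d N δ).measurableSet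
    (by
      rintro σ x ⟨i, j, hij, h⟩
      exact ⟨σ i, σ j, σ.injective.ne hij, h⟩)
    (by
      refine measure_mono_null ?_ (ae_iff.1 hQ2)
      rintro x ⟨i, j, hij, h⟩ hx
      refine hx i j hij ?_
      have h1 := hF (arctanMap d (x i))
      have h2 := hF (arctanMap d (x j))
      have h3 := dist_arctanMap_le (x i) (x j)
      rw [← dist_eq_norm] at h
      rw [dist_comm] at h2
      have h4 := dist_triangle4 (F (arctanMap d (x i))) (arctanMap d (x i)) (arctanMap d (x j))
        (F (arctanMap d (x j)))
      change dist (F (arctanMap d (x i))) (F (arctanMap d (x j))) < 3 * δ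
      linarith)
  exact ⟨δ, hδ, P, hP, hP0⟩

/-- By monotonicity of `ω`, each term is at most `1 / ω(α)` almost everywhere. -/
theorem IsRepulsiveCost.lintegral_lt_top {d N : ℕ} {c : Config d N → ℝ≥0∞}
    (hc : IsRepulsiveCost c) {α : ℝ} (hα : 0 < α) (P : Measure (Config d N)) [IsFiniteMeasure P]
    (hP : P (nearDiagonal d N α) = 0) : ∫⁻ x, c x ∂P < ⊤ := by
  obtain ⟨ω, -, hmono, h0, hcω⟩ := hc
  let C : ℝ≥0∞ := ∑ p : Fin N × Fin N with p.1 < p.2, 1 / (ω α.toNNReal : ℝ≥0∞)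
  have hω : 0 < ω α.toNNReal := h0 ▸ hmono (Real.toNNReal_pos.2 hα)
  have hC : C < ⊤ := ENNReal.sum_lt_top.2 fun _ _ =>
    ENNReal.div_lt_top ENNReal.one_ne_top (by exact_mod_cast hω.ne')
  have hle : ∀ᵐ x ∂P, c x ≤ C := by
    have hae : ∀ᵐ x ∂P, x ∉ nearDiagonal d N α := measure_eq_zero_iff_ae_notMem.1 hP
    filter_upwards [hae] with x hx
    rw [hcω]
    refine Finset.sum_le_sum fun p hp => ENNReal.div_le_div_left ?_ _
    refine ENNReal.coe_le_coe.2 (hmono.monotone (Real.toNNReal_le_iff_le_coe.2 ?_))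
    by_contra h
    exact hx ⟨p.1, p.2, (Finset.mem_filter.1 hp).2.ne, by simpa using h⟩
  calc ∫⁻ x, c x ∂P ≤ ∫⁻ _, C ∂P := lintegral_mono_ae hle
    _ = C * P Set.univ := lintegral_const C
    _ < ⊤ := ENNReal.mul_lt_top hC (measure_lt_top _ _)

end RepulsiveTransport

theorem theorem1p3 (d N : ℕ) (hN : 1 ≤ N)
    (ρ : MeasureTheory.Measure (RepulsiveTransport.Pt d))
    [MeasureTheory.IsProbabilityMeasure ρ]
    (hρ : RepulsiveTransport.concentration ρ < 1 / (N : ℝ≥0∞)) :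
    (∀ c : RepulsiveTransport.Config d N → ℝ≥0∞, RepulsiveTransport.IsRepulsiveCost c →
      RepulsiveTransport.symmetricTransportCost c ρ < ⊤) ∧
    ∃ α : ℝ, 0 < α ∧ ∃ P : MeasureTheory.Measure (RepulsiveTransport.Config d N),
      RepulsiveTransport.IsSymmetricPlan ρ P ∧
      P.support ⊆ (RepulsiveTransport.nearDiagonal d N α)ᶜ ∧
      ∀ c : RepulsiveTransport.Config d N → ℝ≥0∞, RepulsiveTransport.IsRepulsiveCost c →
        ∫⁻ x, c x ∂P < ⊤ := by
  obtain ⟨α, hα, P, hP, hP0⟩ := RepulsiveTransport.exists_separated_symmetric_plan hN ρ hρ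
  have := hP.isProbabilityMeasure
  have hcost : ∀ c : RepulsiveTransport.Config d N → ℝ≥0∞, RepulsiveTransport.IsRepulsiveCost c →
      ∫⁻ x, c x ∂P < ⊤ := fun c hc => hc.lintegral_lt_top hα P hP0
  refine ⟨fun c hc => (iInf₂_le P hP).trans_lt (hcost c hc), α, hα, P, hP, ?_, hcost⟩
  exact Set.subset_compl_comm.1 (MeasureTheory.Measure.subset_compl_support_of_isOpen
    (RepulsiveTransport.isOpen_nearDiagonal d N α) hP0)
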